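/- \textbf{Definitions.} A \emph{Borel Boolean algebra} is a Boolean algebra $\mathbb{B}$ (with $\mathbb{0}\neq\mathbb{1}$) whose underlying set is a Borel subset of the Cantor space ${}^{\omega}2$ and whose order relation $\le$ and incompatibility relation $\perp$ (where $a\perp b$ iff $a\wedge b=\mathbb{0}$) are Borel subsets of ${}^{\omega}2\times{}^{\omega}2$. It is \emph{Borel-homogeneous} if, moreover, the meet $\wedge\colon\mathbb{B}\times\mathbb{B}\to\mathbb{B}$ is a Borel function and for each $b\in\mathbb{B}\setminus\{\mathbb{0}\}$ there is a Borel function $\mathbb{B}\to\mathbb{B}\restriction b=\{c\in\mathbb{B}: c\le b\}$ which is an isomorphism of Boolean algebras. Let $\mathrm{Fin}$ be the ideal of all $f\in{}^{\omega}\mathbb{B}$ such that $\{n<\omega: f(n)\ne\mathbb{0}\}$ is finite, and let ${}^{\omega}\mathbb{B}/\mathrm{Fin}$ be the quotient of the pointwise Boolean algebra ${}^{\omega}\mathbb{B}$ (the reduced power). A \emph{relational system} is a triple $\mathbf{A}=\langle A_-,A,A_+\rangle$ with $A\subseteq A_-\times A_+$. It is \emph{Borel} if $A_-$ and $A_+$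 are Borel subsets of a Polish space $X$, $A$ is a Borel subset of $X\times X$, for every $x\in A_-$ there is $y\in A_+$ with $\langle x,y\rangle\in A$, and for every $y\in A_+$ there is $x\in A_-$ with $\langle x,y\rangle\notin A$. For such $\mathbf{A}$, $\diamondsuit(\mathbf{A})$ is the statement: for every function $F\colon{}^{<\omega_1}2\to A_-$ such that $F\restriction{}^{\delta}2$ is Borel for every $\delta<\omega_1$, there is $g\colon\omega_1\to A_+$ such that for every $f\colon\omega_1\to2$ the set $\{\alpha<\omega_1:\langle F(f\restriction\alpha),g(\alpha)\rangle\in A\}$ is stationary. For a Boolean algebra $\mathbb{A}$, $\mathbf{R}(\mathbb{A})=\langle\mathbb{A},R,\mathbb{A}\setminus\{\mathbb{0}\}\rangle$, where $b\mathrel{R}r$ iff $r\le b$ or $r\wedge b=\mathbb{0}$. As a relational system in the Polish space ${}^{\omega}({}^{\omega}2)$, $\mathbf{R}({}^{\omega}\mathbb{B}/\mathrm{Fin})$ is understood through representatives: its first component is ${}^{\omega}\mathbb{B}$, its last component is ${}^{\omega}\mathbb{B}\setminus\mathrm{Fin}$, and $f$ is related to $g$ iff $[f]_{\mathrm{Fin}}\mathrel{R}[g]_{\mathrm{Fin}}$.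 For an infinite Boolean algebra $\mathbb{A}$, the \emph{ultrafilter number} $\mathfrak{u}(\mathbb{A})$ is the least cofinality of $\langle U,\ge\rangle$ (that is, the least cardinality of a set $Y\subseteq U$ such that every element of $U$ is above some element of $Y$) over all non-principal ultrafilters $U$ on $\mathbb{A}$. \textbf{Theorem.} Let $\mathbb{B}$ be a Borel Boolean algebra. Then $\mathbf{R}({}^{\omega}\mathbb{B}/\mathrm{Fin})$ is a Borel relational system. If, in addition, $\mathbb{B}$ is Borel-homogeneous, then $\diamondsuit(\mathbf{R}({}^{\omega}\mathbb{B}/\mathrm{Fin}))$ implies $\mathfrak{u}({}^{\omega}\mathbb{B}/\mathrm{Fin})=\aleph_1$. -/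

import Mathlib

open scoped Cardinal Ordinal symmDiff

/-! ### Relational systems and parametrized diamonds -/

/-- A relational system `⟨A₋, A, A₊⟩` (with `A ⊆ A₋ × A₊`) whose components live in `X`. -/
structure RelationalSystem (X : Type*) where
  neg : Set X
  pos : Set X
  rel : Set (X × X)
  rel_subset : rel ⊆ neg ×ˢ pos

namespace RelationalSystem

/-- A relational system in a Polish space is Borel if its three components are Borel, every `x ∈ A₋`
is related to some `y ∈ A₊`, and every `y ∈ A₊` fails to be related to some `x ∈ A₋`. -/
structure IsBorel {X : Type*} [TopologicalSpace X] [PolishSpace X] [MeasurableSpace X]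
    [BorelSpace X] (A : RelationalSystem X) : Prop where
  neg_borel : MeasurableSet A.neg
  pos_borel : MeasurableSet A.pos
  rel_borel : MeasurableSet A.rel
  exists_rel : ∀ x ∈ A.neg, ∃ y ∈ A.pos, (x, y) ∈ A.rel
  exists_not_rel : ∀ y ∈ A.pos, ∃ x ∈ A.neg, (x, y) ∉ A.rel

/-- The parametrized diamond principle `◇(A)`. The type `ω₁.ToType` is the set of countable
ordinals; the family `F` is a function on the tree of all `0`-`1` sequences of length `< ω₁`,
`F α` being its restriction to the sequences of length `α`. -/
def Diamond {X : Type*} [TopologicalSpace X] [PolishSpace X] [MeasurableSpace X]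
    [BorelSpace X] (A : RelationalSystem X) : Prop :=
  ∀ F : (α : (ω₁ : Ordinal.{0}).ToType) → (Set.Iio α → Bool) → A.neg,
    (∀ α, Measurable (F α)) →
      ∃ g : (ω₁ : Ordinal.{0}).ToType → A.pos,
        ∀ f : (ω₁ : Ordinal.{0}).ToType → Bool,
          IsStationary {α | ((F α (fun β => f β) : X), (g α : X)) ∈ A.rel}

/-- The relational system on names: if the elements `s ∈ S` are names for the elements `π s`
of `Y`, replace every component of a relational system in `Y` by the set of its names. -/
def onNames {X Y : Type*} (A : RelationalSystem Y) (S : Set X) (π : S → Y) :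
    RelationalSystem X where
  neg := {x | ∃ hx : x ∈ S, π ⟨x, hx⟩ ∈ A.neg}
  pos := {y | ∃ hy : y ∈ S, π ⟨y, hy⟩ ∈ A.pos}
  rel := {p | ∃ (h₁ : p.1 ∈ S) (h₂ : p.2 ∈ S), (π ⟨p.1, h₁⟩, π ⟨p.2, h₂⟩) ∈ A.rel}
  rel_subset := fun _ ⟨h₁, h₂, h⟩ => ⟨⟨h₁, (A.rel_subset h).1⟩, ⟨h₂, (A.rel_subset h).2⟩⟩

end RelationalSystem

/-- The reaping relation `R(B) = ⟨B, R, B⁺⟩` of a Boolean algebra: `b R r` iff `r ≤ b` or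
`r ⊓ b = ⊥`. -/
def reaping (B : Type*) [BooleanAlgebra B] : RelationalSystem B where
  neg := Set.univ
  pos := {r | r ≠ ⊥}
  rel := {p | p.2 ≠ ⊥ ∧ (p.2 ≤ p.1 ∨ p.2 ⊓ p.1 = ⊥)}
  rel_subset := fun _ h => ⟨trivial, h.1⟩

/-! ### Reduced powers -/

/-- The reduced power `B^ω / Fin`: sequences in `B`, identified when they agree at all but finitely
many places; see `ReducedPower.coe_eq_iff`. -/
abbrev ReducedPower (B : Type*) : Type _ := Filter.Germ (Filter.cofinite : Filter ℕ) B

/-- The ideal `Fin` of sequences with finite support. -/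
def finSeq (B : Type*) [BooleanAlgebra B] : Set (ℕ → B) := {f | {n | f n ≠ ⊥}.Finite}

namespace ReducedPower

variable {B : Type*} [BooleanAlgebra B]

/-- The Boolean algebra structure of the reduced power, induced by the pointwise operations. -/
instance instBooleanAlgebra : BooleanAlgebra (ReducedPower B) where
  __ := (inferInstance : DistribLattice (ReducedPower B))
  __ := (inferInstance : BoundedOrder (ReducedPower B))
  compl := Filter.Germ.map compl
  inf_compl_le_bot := fun x => Filter.Germ.inductionOn x fun f =>
    Filter.Eventually.of_forall fun n => (inf_compl_self (a := f n)).le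
  top_le_sup_compl := fun x => Filter.Germ.inductionOn x fun f =>
    Filter.Eventually.of_forall fun n => (sup_compl_eq_top (x := f n)).ge

/-- The class of a sequence is zero iff the sequence is in `Fin`. -/
theorem coe_eq_bot_iff (f : ℕ → B) : (f : ReducedPower B) = ⊥ ↔ f ∈ finSeq B :=
  Filter.Germ.coe_eq.trans Filter.eventually_cofinite

/-- The reduced power is the quotient of `B^ω` by the ideal `Fin`. -/
theorem coe_eq_iff (f g : ℕ → B) :
    (f : ReducedPower B) = (g : ReducedPower B) ↔ f ∆ g ∈ finSeq B := by
  refine Filter.Germ.coe_eq.trans (Filter.eventually_cofinite.trans ?_)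
  simp [finSeq, symmDiff_eq_bot]

end ReducedPower

/-! ### Ultrafilter number -/

/-- An ultrafilter on a Boolean algebra: a proper filter containing `a` or `aᶜ` for every `a`. -/
def IsBooleanUltrafilter {B : Type*} [BooleanAlgebra B] (U : Order.PFilter B) : Prop :=
  ⊥ ∉ U ∧ ∀ a : B, a ∈ U ∨ aᶜ ∈ U

/-- The ultrafilter number: the least cofinality of `⟨U, ≥⟩`, for `U` a non-principal
ultrafilter. -/
noncomputable def ultrafilterNumber (B : Type) [BooleanAlgebra B] : Cardinal.{0} :=
  sInf {κ | ∃ U : Order.PFilter B, IsBooleanUltrafilter U ∧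
    (¬ ∃ a : B, U = Order.PFilter.principal a) ∧ κ = Order.cof ({a : B // a ∈ U}ᵒᵈ)}

/-! ### Borel Boolean algebras -/

/-- A Boolean algebra whose underlying set is a subset of the Cantor space `2^ω`. (The Boolean
operations are arbitrary; in particular they need not be the pointwise ones.) -/
structure CantorBooleanAlgebra where
  dom : Set (ℕ → Bool)
  str : BooleanAlgebra dom

namespace CantorBooleanAlgebra

/-- The type of elements. It is a type synonym of the subtype `𝔹.dom`, so that the order used on it
is the one of the given Boolean algebra and not the pointwise order of `2^ω`. -/
def Elem (𝔹 : CantorBooleanAlgebra) : Type := 𝔹.dom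

variable (𝔹 : CantorBooleanAlgebra)

instance : BooleanAlgebra 𝔹.Elem := 𝔹.str

/-- The Borel structure on the elements as a subspace of the Cantor space. -/
instance : MeasurableSpace 𝔹.Elem := inferInstanceAs (MeasurableSpace 𝔹.dom)

/-- The inclusion of the algebra into the Cantor space. -/
def val (a : 𝔹.Elem) : ℕ → Bool := Subtype.val (p := fun x => x ∈ 𝔹.dom) a

/-- The domain, the order and the incompatibility relation are Borel. -/
structure IsBorel : Prop where
  dom_borel : MeasurableSet 𝔹.dom
  le_borel : MeasurableSet
    {p : (ℕ → Bool) × (ℕ → Bool) | ∃ a b : 𝔹.Elem, p = (𝔹.val a, 𝔹.val b) ∧ a ≤ b}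
  perp_borel : MeasurableSet
    {p : (ℕ → Bool) × (ℕ → Bool) | ∃ a b : 𝔹.Elem, p = (𝔹.val a, 𝔹.val b) ∧ a ⊓ b = ⊥}

/-- Moreover the meet is a Borel function, and every relative algebra `𝔹 ↾ b` with `b ≠ ⊥` is
isomorphic to `𝔹` via a Borel function. (An order isomorphism between Boolean algebras is an
isomorphism of Boolean algebras.) -/
structure IsBorelHomogeneous : Prop extends 𝔹.IsBorel where
  inf_borel : Measurable fun p : 𝔹.Elem × 𝔹.Elem => p.1 ⊓ p.2
  exists_iso : ∀ b : 𝔹.Elem, b ≠ ⊥ → ∃ φ : 𝔹.Elem ≃o Set.Iic b, Measurable φ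

/-- The sequences in `𝔹`, as a subset of the Polish space `(2^ω)^ω`. -/
def seqs : Set (ℕ → ℕ → Bool) := {x | ∀ n, x n ∈ 𝔹.dom}

/-- The class in `𝔹^ω / Fin` of a sequence in `𝔹`. -/
def toReducedPower (x : 𝔹.seqs) : ReducedPower 𝔹.Elem :=
  Filter.Germ.ofFun fun n => (⟨x.1 n, x.2 n⟩ : 𝔹.dom)

instance : PolishSpace (ℕ → ℕ → Bool) := by
  have : TopologicalSpace.IsCompletelyMetrizableSpace (ℕ → Bool) :=
    TopologicalSpace.IsCompletelyMetrizableSpace.pi_countable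
  have : TopologicalSpace.IsCompletelyMetrizableSpace (ℕ → ℕ → Bool) :=
    TopologicalSpace.IsCompletelyMetrizableSpace.pi_countable
  exact { }

/-- The relational system `R(𝔹^ω / Fin)`, presented in the Polish space `(2^ω)^ω` by naming each
element of `𝔹^ω / Fin` by its representatives: `A₋ = 𝔹^ω`, `A₊ = 𝔹^ω \ Fin`, and `f` is related to
`g` iff `[f] R [g]`. -/
def reapingReducedPower : RelationalSystem (ℕ → ℕ → Bool) :=
  (reaping (ReducedPower 𝔹.Elem)).onNames 𝔹.seqs 𝔹.toReducedPower

end CantorBooleanAlgebra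

/-!
Borelness of the reaping relation of `𝔹^ω / Fin` is a count of quantifiers over `ℕ`, and its
non-triviality holds because `𝔹^ω / Fin` has no atoms (`ReducedPower.exists_ne_bot_lt`).

Every ultrafilter on `𝔹^ω / Fin` has uncountable cofinality, since descending sequences of nonzero
elements have nonzero lower bounds and there are no atoms
(`IsBooleanUltrafilter.aleph_one_le_cof`). It remains to build from the diamond an ultrafilter
generated by a tower `⟨U δ : δ < ω₁⟩`, decreasing modulo `Fin`. Given the members below `δ`, fix a
monotone cofinal sequence `η δ` in `δ` and take positions `n₀ < n₁ < ⋯` such that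
`b_k = U (η δ k) n_k` is nonzero and below all `U (η δ j) n_k` with `j ≤ k`. With an isomorphism `φ b` of `𝔹` onto
`𝔹 ↾ b` for each `b ≠ ⊥`, any `x ∉ Fin` gives a nonzero lower bound of the previous members, with value
`φ b_k (x k)` at `n_k` and `⊥` elsewhere. Taking `x = g δ` for the diamond sequence `g` defines
`U δ` (`exists_tower`). It decides `C ∈ 𝔹^ω` as soon as `g δ` reaps the sequence of the preimages of
`C n_k ⊓ b_k` under `φ b_k`.

The function to which the diamond is applied must compute the latter sequence in a Borel way,
although `φ b` need not depend on `b` in a Borel way. The point is that each `b_k` is an entry of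
an earlier member of the tower. So a branch `f : ω₁ → 2` can code, for all `ξ` and `n`, the
preimage `ψ (U ξ n) (C n)` of `C n ⊓ U ξ n` under `φ (U ξ n)`, together with the truth values of
`⊥ ≠ U ξ n ≤ U ζ n`; these determine the positions `n_k`, and the decoding involves no isomorphism
at all (`CantorBooleanAlgebra.codedSeq`). It is correct at every `δ` closed under the coding,
hence on a club (`CantorBooleanAlgebra.codedSeq_codingBranch`, `isClub_closed_under`), and the
diamond provides such a `δ` with `g δ` reaping the decoded sequence.
-/

open Filter Set

/-! ### Diagonal sequences of positions -/

/-- For a relation `P k n`, the sequence `n₀ < n₁ < ⋯` in which `n_k` is the least `n > n_{k-1}`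
with `P k n`; the junk value `0` is taken when there is no such `n`. -/
noncomputable def diagonalPositions (P : ℕ → ℕ → Prop) : ℕ → ℕ
  | 0 => sInf {n | P 0 n}
  | k + 1 => sInf {n | diagonalPositions P k < n ∧ P (k + 1) n}

theorem diagonalPositions_succ_spec {P : ℕ → ℕ → Prop} (h : ∀ k, ∃ᶠ n in cofinite, P k n) (k : ℕ) :
    diagonalPositions P k < diagonalPositions P (k + 1) ∧
      P (k + 1) (diagonalPositions P (k + 1)) := by
  have hk := h (k + 1)
  rw [Nat.cofinite_eq_atTop, frequently_atTop'] at hk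
  obtain ⟨n, hn⟩ := hk (diagonalPositions P k)
  exact Nat.sInf_mem (s := {n | diagonalPositions P k < n ∧ P (k + 1) n}) ⟨n, hn⟩

theorem diagonalPositions_spec {P : ℕ → ℕ → Prop} (h : ∀ k, ∃ᶠ n in cofinite, P k n) :
    ∀ k, P k (diagonalPositions P k)
  | 0 => Nat.sInf_mem (s := {n | P 0 n}) (h 0).exists
  | k + 1 => (diagonalPositions_succ_spec h k).2

theorem diagonalPositions_injective {P : ℕ → ℕ → Prop} (h : ∀ k, ∃ᶠ n in cofinite, P k n) :
    Function.Injective (diagonalPositions P) :=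
  (strictMono_nat_of_lt_succ fun k => (diagonalPositions_succ_spec h k).1).injective

theorem measurable_nat_sInf {Ω : Type*} [MeasurableSpace Ω] {Q : Ω → ℕ → Prop}
    (hQ : ∀ n, MeasurableSet {x | Q x n}) : Measurable fun x => sInf {n | Q x n} := by
  refine measurable_to_countable' fun m => ?_
  have : (fun x => sInf {n | Q x n}) ⁻¹' {m} =
      ({x | Q x m} ∩ ⋂ n, ⋂ (_ : n < m), {x | Q x n}ᶜ) ∪
        ({_x | m = 0} ∩ ⋂ n, {x | Q x n}ᶜ) := by
    ext x
    simp only [mem_preimage, mem_singleton_iff, mem_union, mem_inter_iff, mem_iInter, mem_compl_iff,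
      mem_ofPred_eq]
    constructor
    · rintro rfl
      by_cases hne : {n | Q x n}.Nonempty
      · exact Or.inl ⟨Nat.sInf_mem hne, fun n hn => Nat.notMem_of_lt_sInf hn⟩
      · rw [not_nonempty_iff_eq_empty] at hne
        refine Or.inr ⟨by rw [hne, Nat.sInf_empty], fun n hn => ?_⟩
        exact (hne ▸ hn : n ∈ (∅ : Set ℕ))
    · rintro (⟨h, h'⟩ | ⟨rfl, h⟩)
      · exact le_antisymm (Nat.sInf_le h)
          (not_lt.1 fun hlt => h' _ hlt (Nat.sInf_mem (s := {n | Q x n}) ⟨m, h⟩))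
      · rw [eq_empty_of_forall_notMem (s := {n | Q x n}) h, Nat.sInf_empty]
  rw [this]
  exact ((hQ m).inter (.iInter fun n => .iInter fun _ => (hQ n).compl)).union
    ((MeasurableSet.const _).inter (.iInter fun n => (hQ n).compl))

theorem measurable_diagonalPositions {Ω : Type*} [MeasurableSpace Ω] {P : Ω → ℕ → ℕ → Prop}
    (hP : ∀ k n, MeasurableSet {x | P x k n}) (k : ℕ) :
    Measurable fun x => diagonalPositions (P x) k := by
  induction k with
  | zero => exact measurable_nat_sInf (hP 0)
  | succ k ih =>
    exact measurable_nat_sInf fun n => (measurableSet_lt ih measurable_const).inter (hP (k + 1) n)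

/-! ### Diagonal lower bounds modulo finite -/

section Spread

variable {B : Type*} [BooleanAlgebra B]

/-- The position `n` is good for the entry `V k` of a sequence of sequences if `V k n` is a nonzero
lower bound of all earlier entries at `n`. -/
def IsGoodPosition (V : ℕ → ℕ → B) (k n : ℕ) : Prop := ∀ j ≤ k, V k n ≠ ⊥ ∧ V k n ≤ V j n

theorem frequently_isGoodPosition {V : ℕ → ℕ → B} (hne : ∀ k, ∃ᶠ n in cofinite, V k n ≠ ⊥)
    (hle : ∀ j k, j ≤ k → ∀ᶠ n in cofinite, V k n ≤ V j n) (k : ℕ) :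
    ∃ᶠ n in cofinite, IsGoodPosition V k n := by
  have : ∀ᶠ n in cofinite, ∀ j ∈ Finset.range (k + 1), V k n ≤ V j n :=
    (Filter.eventually_all_finset _).2 fun j hj => hle j k (Finset.mem_range_succ_iff.1 hj)
  exact ((hne k).and_eventually this).mono fun n h j hj =>
    ⟨h.1, h.2 j (Finset.mem_range_succ_iff.2 hj)⟩

/-- The sequence with value `y k` at the position `N k`, and `⊥` off the range of `N`. -/
noncomputable def spread (N : ℕ → ℕ) (y : ℕ → B) : ℕ → B := Function.extend N y fun _ => ⊥

theorem spread_apply {N : ℕ → ℕ} (hN : N.Injective) (y : ℕ → B) (k : ℕ) :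
    spread N y (N k) = y k := hN.extend_apply _ _ _

/-- A property of the values of a spread sequence that `⊥` has everywhere holds almost everywhere
as soon as it holds at almost all of the chosen positions. -/
theorem eventually_spread {N : ℕ → ℕ} (hN : N.Injective) {y : ℕ → B} {p : ℕ → B → Prop}
    (hbot : ∀ n, p n ⊥) (h : ∀ᶠ k in cofinite, p (N k) (y k)) :
    ∀ᶠ n in cofinite, p n (spread N y n) := by
  rw [eventually_cofinite] at h ⊢
  refine (h.image N).subset fun n hn => ?_
  by_cases hk : ∃ k, N k = n
  · obtain ⟨k, rfl⟩ := hk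
    exact ⟨k, by simpa [spread_apply hN] using hn, rfl⟩
  · exact absurd (hbot n) (by simpa [spread, Function.extend_apply' _ _ _ hk] using hn)

theorem frequently_spread {N : ℕ → ℕ} (hN : N.Injective) {y : ℕ → B}
    (h : ∃ᶠ k in cofinite, y k ≠ ⊥) : ∃ᶠ n in cofinite, spread N y n ≠ ⊥ :=
  hN.tendsto_cofinite.frequently (h.mono fun k hk => by rwa [spread_apply hN])

/-- Elements below the entries of `V` at good positions yield a lower bound of all the `V j`. -/
theorem spread_eventually_le {V : ℕ → ℕ → B} (hV : ∀ k, ∃ᶠ n in cofinite, IsGoodPosition V k n)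
    {y : ℕ → B} (hy : ∀ k, y k ≤ V k (diagonalPositions (IsGoodPosition V) k)) (j : ℕ) :
    ∀ᶠ n in cofinite, spread (diagonalPositions (IsGoodPosition V)) y n ≤ V j n := by
  refine eventually_spread (p := fun n b => b ≤ V j n) (diagonalPositions_injective hV)
    (fun _ => bot_le) ?_
  rw [Nat.cofinite_eq_atTop]
  filter_upwards [eventually_ge_atTop j] with k hk
  exact (hy k).trans (diagonalPositions_spec hV k j hk).2

end Spread

/-! ### Reduced powers are atomless and countably closed -/

section ReducedPower

variable {B : Type*} [BooleanAlgebra B]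

theorem ReducedPower.coe_ne_bot_iff (f : ℕ → B) :
    (f : ReducedPower B) ≠ ⊥ ↔ ∃ᶠ n in cofinite, f n ≠ ⊥ := by
  rw [Ne, ReducedPower.coe_eq_bot_iff, Filter.frequently_cofinite_iff_infinite]
  rfl

/-- A nonzero element can be cut down to every other place of the support of a representative. -/
theorem ReducedPower.exists_ne_bot_lt {p : ReducedPower B} (hp : p ≠ ⊥) :
    ∃ q : ReducedPower B, q ≠ ⊥ ∧ q < p := by
  classical
  induction p using Filter.Germ.inductionOn with | _ x =>
  rw [coe_ne_bot_iff, Filter.frequently_cofinite_iff_infinite] at hp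
  let N := Nat.nth fun n => x n ≠ ⊥
  have hN : N.Injective := Nat.nth_injective hp
  have hx : ∀ k, x (N k) ≠ ⊥ := Nat.nth_mem_of_infinite hp
  -- Keep the members of the support with even index.
  have hN₂ : (fun k => N (2 * k)).Injective := hN.comp fun a b h => by simpa using h
  let y := spread (fun k => N (2 * k)) fun k => x (N (2 * k))
  refine ⟨(y : ReducedPower B), (coe_ne_bot_iff _).2 <| frequently_spread hN₂ <|
    (Eventually.of_forall fun k => hx _).frequently, lt_of_le_not_ge ?_ fun hle => ?_⟩
  · exact Filter.Germ.coe_le.2 <| eventually_spread (p := fun n b => b ≤ x n) hN₂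
      (fun _ => bot_le) (Eventually.of_forall fun k => le_rfl)
  · have hN₁ : (fun k => N (2 * k + 1)).Injective := hN.comp fun a b h => by simpa using h
    obtain ⟨k, hk⟩ := (hN₁.tendsto_cofinite.eventually (Filter.Germ.coe_le.1 hle)).exists
    have hy : y (N (2 * k + 1)) = ⊥ := Function.extend_apply' _ _ _ fun ⟨j, hj⟩ => by
      have := hN hj
      omega
    exact hx _ (le_bot_iff.1 (hy ▸ hk))

/-- A descending sequence of nonzero elements has a nonzero lower bound, obtained by taking the
`k`-th representative at the `k`-th diagonal position. -/
theorem ReducedPower.exists_ne_bot_forall_le {z : ℕ → ReducedPower B} (hz : Antitone z)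
    (hne : ∀ k, z k ≠ ⊥) : ∃ p : ReducedPower B, p ≠ ⊥ ∧ ∀ k, p ≤ z k := by
  choose V hV using fun k => Quot.exists_rep (z k)
  have hV' : ∀ k, (V k : ReducedPower B) = z k := hV
  have hgood := frequently_isGoodPosition (V := V)
    (fun k => (coe_ne_bot_iff _).1 (hV' k ▸ hne k))
    fun j k hjk => Filter.Germ.coe_le.1 (by rw [hV' j, hV' k]; exact hz hjk)
  refine ⟨((spread (diagonalPositions (IsGoodPosition V))
    fun k => V k (diagonalPositions (IsGoodPosition V) k) : ℕ → B) : ReducedPower B),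
    (coe_ne_bot_iff _).2 <| frequently_spread (diagonalPositions_injective hgood) <|
    (Eventually.of_forall fun k => (diagonalPositions_spec hgood k k le_rfl).1).frequently,
    fun k => ?_⟩
  rw [← hV' k]
  exact Filter.Germ.coe_le.2 (spread_eventually_le hgood (fun _ => le_rfl) k)

end ReducedPower

/-! ### Cofinality of ultrafilters -/

/-- A descending chain of nonzero elements deciding every element generates an ultrafilter. -/
theorem exists_isBooleanUltrafilter_of_antitone {I A : Type} [LinearOrder I] [Nonempty I]
    [BooleanAlgebra A] {u : I → A} (hu : Antitone u) (hne : ∀ i, u i ≠ ⊥)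
    (hdec : ∀ c, ∃ i, u i ≤ c ∨ u i ⊓ c = ⊥) :
    ∃ U : Order.PFilter A, IsBooleanUltrafilter U ∧ Order.cof {a : A // a ∈ U}ᵒᵈ ≤ #I := by
  have hF : Order.IsPFilter {c | ∃ i, u i ≤ c} := by
    refine .of_def ⟨_, Classical.arbitrary I, le_rfl⟩ ?_ fun hxy ⟨i, hi⟩ => ⟨i, hi.trans hxy⟩
    rintro a ⟨i, hi⟩ b ⟨j, hj⟩
    exact ⟨u (max i j), ⟨_, le_rfl⟩, (hu (le_max_left i j)).trans hi,
      (hu (le_max_right i j)).trans hj⟩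
  have hmem : ∀ c, c ∈ hF.toPFilter ↔ ∃ i, u i ≤ c := fun c => Iff.rfl
  refine ⟨hF.toPFilter, ⟨?_, fun c => ?_⟩, ?_⟩
  · rw [hmem]
    exact fun ⟨i, hi⟩ => hne i (le_bot_iff.1 hi)
  · obtain ⟨i, hi | hi⟩ := hdec c
    · exact Or.inl ((hmem _).2 ⟨i, hi⟩)
    · exact Or.inr ((hmem _).2 ⟨i, le_compl_iff_disjoint_right.2 (disjoint_iff.2 hi)⟩)
  · let v : I → {a : A // a ∈ hF.toPFilter}ᵒᵈ := fun i =>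
      OrderDual.toDual ⟨u i, (hmem _).2 ⟨i, le_rfl⟩⟩
    have hv : IsCofinal (range v) := fun a => by
      obtain ⟨i, hi⟩ := (hmem _).1 (OrderDual.ofDual a).2
      exact ⟨v i, ⟨i, rfl⟩, hi⟩
    exact (Order.cof_le hv).trans Cardinal.mk_range_le

/-- The elements of a countable base would have a common nonzero lower bound, below every element of
the ultrafilter and hence an atom; but there are no atoms. -/
theorem IsBooleanUltrafilter.aleph_one_le_cof {B : Type} [BooleanAlgebra B]
    {U : Order.PFilter (ReducedPower B)} (hU : IsBooleanUltrafilter U) :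
    ℵ₁ ≤ Order.cof {a : ReducedPower B // a ∈ U}ᵒᵈ := by
  rw [Order.le_cof_iff]
  intro s hs
  by_contra! hlt
  have hcount : s.Countable := by
    rwa [← Set.countable_coe_iff, ← Cardinal.mk_le_aleph0_iff, ← Order.lt_succ_iff,
      Cardinal.succ_aleph0]
  have : Nonempty {a : ReducedPower B // a ∈ U}ᵒᵈ :=
    ⟨OrderDual.toDual ⟨⊤, Order.PFilter.top_mem⟩⟩
  obtain ⟨y, rfl⟩ := hcount.exists_eq_range hs.nonempty
  let z : ℕ → ReducedPower B := fun k =>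
    (Finset.range (k + 1)).inf fun i => (OrderDual.ofDual (y i)).1
  have hz : ∀ k, z k ∈ U := fun k => by
    refine Finset.inf_induction (p := (· ∈ U)) Order.PFilter.top_mem
      (fun a ha b hb => Order.PFilter.inf_mem ha hb) fun i _ => (OrderDual.ofDual (y i)).2
  obtain ⟨p, hp, hpz⟩ := ReducedPower.exists_ne_bot_forall_le (z := z)
    (fun j k hjk => Finset.inf_mono (Finset.range_mono (by omega)))
    fun k hk => hU.1 (hk ▸ hz k)
  have hpU : ∀ c ∈ U, p ≤ c := fun c hc => by
    obtain ⟨_, ⟨k, rfl⟩, hk⟩ := hs (OrderDual.toDual ⟨c, hc⟩)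
    exact ((hpz k).trans (Finset.inf_le (Finset.self_mem_range_succ k))).trans hk
  obtain ⟨q, hq, hqp⟩ := ReducedPower.exists_ne_bot_lt hp
  obtain h | h := hU.2 q
  · exact hqp.not_ge (hpU _ h)
  · exact hq (disjoint_self.1 (le_compl_iff_disjoint_right.1 (hqp.le.trans (hpU _ h))))

/-- As every ultrafilter on a reduced power has uncountable cofinality, an ultrafilter of cofinality
at most `ℵ₁` is non-principal and witnesses the value `ℵ₁` of the ultrafilter number. -/
theorem ultrafilterNumber_eq_aleph_one {B : Type} [BooleanAlgebra B]
    {U : Order.PFilter (ReducedPower B)} (hU : IsBooleanUltrafilter U)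
    (hcof : Order.cof {a : ReducedPower B // a ∈ U}ᵒᵈ ≤ ℵ₁) :
    ultrafilterNumber (ReducedPower B) = ℵ₁ := by
  have hmem : ℵ₁ ∈ {κ | ∃ U : Order.PFilter (ReducedPower B), IsBooleanUltrafilter U ∧
      (¬ ∃ a, U = Order.PFilter.principal a) ∧
      κ = Order.cof ({a : ReducedPower B // a ∈ U}ᵒᵈ)} := by
    refine ⟨U, hU, ?_, le_antisymm hU.aleph_one_le_cof hcof⟩
    rintro ⟨a, rfl⟩
    have hs : IsCofinal ({OrderDual.toDual ⟨a, Order.PFilter.mem_principal.2 le_rfl⟩} :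
        Set {b : ReducedPower B // b ∈ Order.PFilter.principal a}ᵒᵈ) :=
      fun b => ⟨_, rfl, (OrderDual.ofDual b).2⟩
    have h := hU.aleph_one_le_cof.trans (Order.cof_le hs)
    rw [Cardinal.mk_singleton] at h
    exact (Cardinal.one_lt_aleph0.trans Cardinal.aleph0_lt_aleph_one).not_ge h
  refine le_antisymm (csInf_le' hmem) (le_csInf ⟨_, hmem⟩ ?_)
  rintro _ ⟨V, hV, -, rfl⟩
  exact hV.aleph_one_le_cof

/-! ### Countable ordinals -/

section CountableOrdinals

/-- The type of countable ordinals. -/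
abbrev OmegaOne : Type := (ω₁ : Ordinal.{0}).ToType

theorem cardinalMk_omega_one_toType : #OmegaOne = ℵ₁ := by simp

theorem countable_Iio_omega_one_toType (δ : OmegaOne) : (Iio δ).Countable := by
  rw [← Set.countable_coe_iff, ← Cardinal.mk_le_aleph0_iff, ← Order.lt_succ_iff,
    Cardinal.succ_aleph0]
  have h := Cardinal.mk_Iio_lt δ (by simp)
  rwa [cardinalMk_omega_one_toType] at h

theorem exists_gt_of_countable {s : Set OmegaOne} (hs : s.Countable) : ∃ x, ∀ y ∈ s, y < x := by
  rw [← not_isCofinal_iff]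
  intro h
  have h₁ := Order.cof_le h
  rw [Ordinal.cof_toType, Cardinal.cof_omega_one] at h₁
  exact (h₁.trans hs.le_aleph0).not_gt Cardinal.aleph0_lt_aleph_one

/-- Every non-minimal `δ` has a monotone sequence cofinal in the ordinals below it, eventually
constant if `δ` is a successor. -/
theorem exists_monotone_cofinal (δ : OmegaOne) : ∃ η : ℕ → OmegaOne, (Iio δ).Nonempty →
    Monotone η ∧ (∀ k, η k < δ) ∧ ∀ ξ < δ, ∃ k, ξ ≤ η k := by
  by_cases h : (Iio δ).Nonempty
  · obtain ⟨y, hy⟩ := (countable_Iio_omega_one_toType δ).exists_eq_range h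
    refine ⟨partialSups y, fun _ => ⟨(partialSups y).monotone, fun k => ?_, fun ξ hξ => ?_⟩⟩
    · obtain ⟨j, -, hj⟩ := exists_partialSups_eq y k
      rw [hj, ← mem_Iio, hy]
      exact mem_range_self j
    · obtain ⟨k, rfl⟩ : ξ ∈ range y := hy ▸ hξ
      exact ⟨k, le_partialSups y k⟩
  · exact ⟨fun _ => δ, fun h' => absurd h' h⟩

/-- The non-minimal closure points of a function on `ω₁ × ω₁ × ℕ × ℕ` form a club, since countable
sets of countable ordinals are bounded. -/
theorem isClub_closed_under (e : OmegaOne × OmegaOne × ℕ × ℕ → OmegaOne) :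
    IsClub {δ | (Iio δ).Nonempty ∧ ∀ ξ < δ, ∀ ζ < δ, ∀ n i, e (ξ, ζ, n, i) < δ} := by
  constructor
  · intro t ht htne _ δ hδ
    refine ⟨?_, fun ξ hξ ζ hζ n i => ?_⟩
    · obtain ⟨x, hx⟩ := htne
      obtain ⟨y, hy⟩ := (ht hx).1
      exact ⟨y, lt_of_lt_of_le hy (hδ.1 hx)⟩
    · obtain ⟨x, hx, hlt⟩ := (lt_isLUB_iff hδ).1 (max_lt hξ hζ)
      exact ((ht hx).2 _ ((le_max_left _ _).trans_lt hlt) _ ((le_max_right _ _).trans_lt hlt)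
        n i).trans_le (hδ.1 hx)
  · intro a
    have hcount : ∀ x : OmegaOne, (insert x (e '' (Iic x ×ˢ Iic x ×ˢ univ))).Countable := by
      intro x
      have hx : (Iic x).Countable := by
        rw [← Iio_insert]
        exact (countable_Iio_omega_one_toType x).insert x
      exact ((hx.prod (hx.prod countable_univ)).image e).insert x
    choose h hh using fun x => exists_gt_of_countable (hcount x)
    have hself : ∀ x, x < h x := fun x => hh x x (mem_insert _ _)
    -- The least upper bound of the iterates of `h` at `a` is a closure point.
    let s : ℕ → OmegaOne := fun n => h^[n] a
    have hs : ∀ n, s (n + 1) = h (s n) := fun n => Function.iterate_succ_apply' h n a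
    have hsmono : Monotone s := monotone_nat_of_le_succ fun n => by
      rw [hs]
      exact (hself _).le
    obtain ⟨b, hb⟩ := exists_gt_of_countable (countable_range s)
    obtain ⟨δ, hδ, hmin⟩ := (wellFounded_lt (α := OmegaOne)).has_min (upperBounds (range s))
      ⟨b, fun y hy => (hb y hy).le⟩
    have hle : ∀ n, s n ≤ δ := fun n => hδ ⟨n, rfl⟩
    have hlt : ∀ n, s n < δ := fun n => (hself (s n)).trans_le (hs n ▸ hle (n + 1))
    have hex : ∀ ξ < δ, ∃ n, ξ ≤ s n := fun ξ hξ => by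
      by_contra! hcon
      exact hmin ξ (by rintro _ ⟨n, rfl⟩; exact (hcon n).le) hξ
    refine ⟨δ, ⟨⟨s 0, hlt 0⟩, fun ξ hξ ζ hζ n i => ?_⟩, hle 0⟩
    obtain ⟨j, hj⟩ := hex ξ hξ
    obtain ⟨k, hk⟩ := hex ζ hζ
    refine lt_of_lt_of_le (hh (s (max j k)) _ (mem_insert_of_mem _ ⟨(ξ, ζ, n, i), ⟨?_, ?_, trivial⟩,
      rfl⟩)) (hs (max j k) ▸ hle _)
    · exact hj.trans (hsmono (le_max_left _ _))
    · exact hk.trans (hsmono (le_max_right _ _))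

theorem exists_injective_code : ∃ e : OmegaOne × OmegaOne × ℕ × ℕ → OmegaOne, e.Injective := by
  have h : #(OmegaOne × OmegaOne × ℕ × ℕ) ≤ #OmegaOne := by
    rw [Cardinal.mk_prod, Cardinal.mk_prod, Cardinal.mk_prod]
    simp
  obtain ⟨e⟩ := h
  exact ⟨e, e.injective⟩

end CountableOrdinals

/-! ### The tower -/

section Tower

variable {B : Type*} [BooleanAlgebra B] {I : Type*} [LinearOrder I] [WellFoundedLT I]

/-- A recursion along a well-order produces a tower modulo finite. Its member at a non-minimal `δ`
is a diagonal lower bound of the members at the `η δ k`, for `η δ` cofinal below `δ`, in which the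
entry at the `k`-th position is the copy of `g δ k` under the map `φ b` into the elements below the
entry `b`. -/
theorem exists_tower {η : I → ℕ → I}
    (hη : ∀ δ, (Iio δ).Nonempty → Monotone (η δ) ∧ (∀ k, η δ k < δ) ∧ ∀ ξ < δ, ∃ k, ξ ≤ η δ k)
    {φ : B → B → B} (hφ : ∀ b x, φ b x ≤ b) (hφ₀ : ∀ b x, b ≠ ⊥ → (φ b x = ⊥ ↔ x = ⊥))
    {g : I → ℕ → B} (hg : ∀ δ, ∃ᶠ n in cofinite, g δ n ≠ ⊥) :
    ∃ U : I → ℕ → B, (∀ δ, ∃ᶠ n in cofinite, U δ n ≠ ⊥) ∧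
      (∀ ξ δ, ξ ≤ δ → ∀ᶠ n in cofinite, U δ n ≤ U ξ n) ∧
      ∀ δ, (Iio δ).Nonempty → (∀ k, ∃ᶠ n in cofinite, IsGoodPosition (fun k => U (η δ k)) k n) ∧
        U δ = spread (diagonalPositions (IsGoodPosition fun k => U (η δ k))) fun k =>
          φ (U (η δ k) (diagonalPositions (IsGoodPosition fun k => U (η δ k)) k)) (g δ k) := by
  classical
  let step : (δ : I) → ((ξ : I) → ξ < δ → ℕ → B) → ℕ → B := fun δ IH =>
    if h : (Iio δ).Nonempty then
      let V : ℕ → ℕ → B := fun k => IH (η δ k) ((hη δ h).2.1 k)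
      spread (diagonalPositions (IsGoodPosition V)) fun k =>
        φ (V k (diagonalPositions (IsGoodPosition V) k)) (g δ k)
    else g δ
  let U : I → ℕ → B := (wellFounded_lt (α := I)).fix step
  have hU : ∀ δ, U δ = step δ fun ξ _ => U ξ := fun δ => WellFounded.fix_eq _ _ _
  have hUpos : ∀ δ, (Iio δ).Nonempty →
      U δ = spread (diagonalPositions (IsGoodPosition fun k => U (η δ k))) fun k =>
        φ (U (η δ k) (diagonalPositions (IsGoodPosition fun k => U (η δ k)) k)) (g δ k) := by
    intro δ h
    rw [hU δ]
    simp only [step, dif_pos h]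
  have key : ∀ δ, (∃ᶠ n in cofinite, U δ n ≠ ⊥) ∧
      (∀ ξ, ξ ≤ δ → ∀ᶠ n in cofinite, U δ n ≤ U ξ n) ∧ ((Iio δ).Nonempty →
        ∀ k, ∃ᶠ n in cofinite, IsGoodPosition (fun k => U (η δ k)) k n) := by
    intro δ
    induction δ using WellFoundedLT.induction with | _ δ IH =>
    by_cases h : (Iio δ).Nonempty
    · obtain ⟨hmono, hlt, hcof⟩ := hη δ h
      have hgood := frequently_isGoodPosition (V := fun k => U (η δ k))
        (fun k => (IH _ (hlt k)).1) fun j k hjk => (IH _ (hlt k)).2.1 _ (hmono hjk)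
      refine ⟨?_, fun ξ hξ => ?_, fun _ => hgood⟩
      · rw [hUpos δ h]
        refine frequently_spread (diagonalPositions_injective hgood) ((hg δ).mono fun k hk => ?_)
        rwa [Ne, hφ₀ _ _ (diagonalPositions_spec hgood k k le_rfl).1]
      · obtain rfl | hξ := hξ.eq_or_lt
        · exact Eventually.of_forall fun _ => le_rfl
        · obtain ⟨k, hk⟩ := hcof ξ hξ
          have h₁ := spread_eventually_le hgood
            (y := fun k =>
              φ (U (η δ k) (diagonalPositions (IsGoodPosition fun k => U (η δ k)) k)) (g δ k))
            (fun k => hφ _ _) k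
          rw [← hUpos δ h] at h₁
          filter_upwards [h₁, (IH _ (hlt k)).2.1 ξ hk] with n using le_trans
    · refine ⟨?_, fun ξ hξ => ?_, fun h' => absurd h' h⟩
      · rw [hU δ]
        simpa only [step, dif_neg h] using hg δ
      · obtain rfl | hξ := hξ.eq_or_lt
        · exact Eventually.of_forall fun _ => le_rfl
        · exact absurd ⟨ξ, hξ⟩ h
  exact ⟨U, fun δ => (key δ).1, fun ξ δ h => (key δ).2.1 ξ h, fun δ h => ⟨(key δ).2.2 h, hUpos δ h⟩⟩

end Tower

/-! ### The reaping relation of the reduced power is Borel -/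

theorem measurableSet_eventually_cofinite {X : Type*} [MeasurableSpace X] {p : ℕ → X → Prop}
    (hp : ∀ n, MeasurableSet {x | p n x}) : MeasurableSet {x | ∀ᶠ n in cofinite, p n x} := by
  have : {x | ∀ᶠ n in cofinite, p n x} = ⋃ N, ⋂ n, ⋂ (_ : N ≤ n), {x | p n x} := by
    ext x
    simp [Nat.cofinite_eq_atTop]
  rw [this]
  exact .iUnion fun N => .iInter fun n => .iInter fun _ => hp n

namespace CantorBooleanAlgebra

variable (𝔹 : CantorBooleanAlgebra)

/-- The sequence of elements of `𝔹` given by a point of `𝔹.seqs`. -/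
def elemSeq (x : 𝔹.seqs) : ℕ → 𝔹.Elem := fun n => (⟨x.1 n, x.2 n⟩ : 𝔹.dom)

theorem val_injective : Function.Injective 𝔹.val := Subtype.val_injective

theorem val_mem (a : 𝔹.Elem) : 𝔹.val a ∈ 𝔹.dom := Subtype.property (p := fun x => x ∈ 𝔹.dom) a

theorem val_elemSeq (x : 𝔹.seqs) (n : ℕ) : 𝔹.val (𝔹.elemSeq x n) = x.1 n := rfl

theorem mem_reapingReducedPower_neg {x : ℕ → ℕ → Bool} :
    x ∈ 𝔹.reapingReducedPower.neg ↔ x ∈ 𝔹.seqs :=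
  ⟨fun ⟨h, _⟩ => h, fun h => ⟨h, trivial⟩⟩

theorem mem_reapingReducedPower_pos {y : ℕ → ℕ → Bool} :
    y ∈ 𝔹.reapingReducedPower.pos ↔
      ∃ hy : y ∈ 𝔹.seqs, ∃ᶠ n in cofinite, 𝔹.elemSeq ⟨y, hy⟩ n ≠ ⊥ :=
  exists_congr fun hy => ReducedPower.coe_ne_bot_iff (𝔹.elemSeq ⟨y, hy⟩)

theorem mem_reapingReducedPower_rel {x y : ℕ → ℕ → Bool} :
    (x, y) ∈ 𝔹.reapingReducedPower.rel ↔
      ∃ (hx : x ∈ 𝔹.seqs) (hy : y ∈ 𝔹.seqs), (∃ᶠ n in cofinite, 𝔹.elemSeq ⟨y, hy⟩ n ≠ ⊥) ∧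
        ((∀ᶠ n in cofinite, 𝔹.elemSeq ⟨y, hy⟩ n ≤ 𝔹.elemSeq ⟨x, hx⟩ n) ∨
          ∀ᶠ n in cofinite, 𝔹.elemSeq ⟨y, hy⟩ n ⊓ 𝔹.elemSeq ⟨x, hx⟩ n = ⊥) :=
  exists_congr fun hx => exists_congr fun hy =>
    and_congr (ReducedPower.coe_ne_bot_iff (𝔹.elemSeq ⟨y, hy⟩)) (or_congr
      (Filter.Germ.coe_le (f := 𝔹.elemSeq ⟨y, hy⟩) (g := 𝔹.elemSeq ⟨x, hx⟩))
      (Filter.Germ.coe_eq (f := 𝔹.elemSeq ⟨y, hy⟩ ⊓ 𝔹.elemSeq ⟨x, hx⟩)))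

variable {𝔹} in
theorem IsBorel.measurableSet_seqs (h : 𝔹.IsBorel) : MeasurableSet 𝔹.seqs := by
  have : 𝔹.seqs = ⋂ n, (fun x : ℕ → ℕ → Bool => x n) ⁻¹' 𝔹.dom := by
    ext x
    simp [seqs]
  rw [this]
  exact .iInter fun n => measurable_pi_apply n h.dom_borel

variable {𝔹} in
theorem IsBorel.measurableSet_pos (h : 𝔹.IsBorel) :
    MeasurableSet 𝔹.reapingReducedPower.pos := by
  have : 𝔹.reapingReducedPower.pos =
      𝔹.seqs ∩ {y | ∀ᶠ n in cofinite, y n = 𝔹.val ⊥}ᶜ := by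
    ext y
    rw [mem_reapingReducedPower_pos, mem_inter_iff, ← exists_prop]
    refine exists_congr fun hy => not_congr (eventually_congr (.of_forall fun n => ?_))
    rw [not_not, ← 𝔹.val_injective.eq_iff, val_elemSeq]
  rw [this]
  exact h.measurableSet_seqs.inter (measurableSet_eventually_cofinite fun n =>
    measurable_pi_apply n (measurableSet_singleton _)).compl

variable {𝔹} in
theorem IsBorel.measurableSet_rel (h : 𝔹.IsBorel) :
    MeasurableSet 𝔹.reapingReducedPower.rel := by
  have : 𝔹.reapingReducedPower.rel = (𝔹.seqs ×ˢ 𝔹.reapingReducedPower.pos) ∩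
      ({p | ∀ᶠ n in cofinite, (p.2 n, p.1 n) ∈
          {p | ∃ a b : 𝔹.Elem, p = (𝔹.val a, 𝔹.val b) ∧ a ≤ b}} ∪
        {p | ∀ᶠ n in cofinite, (p.2 n, p.1 n) ∈
          {p | ∃ a b : 𝔹.Elem, p = (𝔹.val a, 𝔹.val b) ∧ a ⊓ b = ⊥}}) := by
    have key : ∀ (r : 𝔹.Elem → 𝔹.Elem → Prop) (a b : 𝔹.Elem),
        (𝔹.val a, 𝔹.val b) ∈ {p | ∃ a b : 𝔹.Elem, p = (𝔹.val a, 𝔹.val b) ∧ r a b} ↔ r a b := by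
      intro r a b
      constructor
      · rintro ⟨a', b', hab, hr⟩
        rw [Prod.mk.injEq, 𝔹.val_injective.eq_iff, 𝔹.val_injective.eq_iff] at hab
        rwa [hab.1, hab.2]
      · exact fun hr => ⟨a, b, rfl, hr⟩
    ext ⟨x, y⟩
    rw [mem_reapingReducedPower_rel, mem_inter_iff, mem_prod, mem_reapingReducedPower_pos]
    constructor
    · rintro ⟨hx, hy, hne, hr⟩
      exact ⟨⟨hx, hy, hne⟩, hr.imp
        (fun hr => hr.mono fun n => (key (· ≤ ·) _ _).2)
        fun hr => hr.mono fun n => (key (fun a b => a ⊓ b = ⊥) _ _).2⟩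
    · rintro ⟨⟨hx, hy, hne⟩, hr⟩
      refine ⟨hx, hy, hne, hr.imp (fun hr => ?_) fun hr => ?_⟩ <;> rw [mem_ofPred_eq] at hr
      · exact hr.mono fun n =>
          (key (· ≤ ·) (𝔹.elemSeq ⟨y, hy⟩ n) (𝔹.elemSeq ⟨x, hx⟩ n)).1
      · exact hr.mono fun n =>
          (key (fun a b => a ⊓ b = ⊥) (𝔹.elemSeq ⟨y, hy⟩ n) (𝔹.elemSeq ⟨x, hx⟩ n)).1
  rw [this]
  have hm : ∀ n, Measurable fun p : (ℕ → ℕ → Bool) × (ℕ → ℕ → Bool) => (p.2 n, p.1 n) :=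
    fun n => ((measurable_pi_apply n).comp measurable_snd).prodMk
      ((measurable_pi_apply n).comp measurable_fst)
  exact (h.measurableSet_seqs.prod h.measurableSet_pos).inter
    ((measurableSet_eventually_cofinite fun n => hm n h.le_borel).union
      (measurableSet_eventually_cofinite fun n => hm n h.perp_borel))

theorem exists_toReducedPower_eq (c : ReducedPower 𝔹.Elem) :
    ∃ x : 𝔹.seqs, 𝔹.toReducedPower x = c := by
  induction c using Filter.Germ.inductionOn with | _ f =>
  exact ⟨⟨fun n => 𝔹.val (f n), fun n => 𝔹.val_mem (f n)⟩, rfl⟩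

variable {𝔹} in
theorem IsBorel.isBorel_reapingReducedPower [Nontrivial 𝔹.Elem] (h : 𝔹.IsBorel) :
    𝔹.reapingReducedPower.IsBorel where
  neg_borel := by
    convert h.measurableSet_seqs using 1
    exact Set.ext fun x => 𝔹.mem_reapingReducedPower_neg
  pos_borel := h.measurableSet_pos
  rel_borel := h.measurableSet_rel
  exists_rel := by
    rintro x ⟨hx, -⟩
    -- A nonzero `x` is reaped by itself, and zero is reaped by `⊤`.
    by_cases h₀ : 𝔹.toReducedPower ⟨x, hx⟩ = ⊥
    · obtain ⟨⟨y, hy⟩, hy₁⟩ := 𝔹.exists_toReducedPower_eq ⊤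
      have hne : 𝔹.toReducedPower ⟨y, hy⟩ ≠ ⊥ := by
        rw [hy₁]
        exact (ReducedPower.coe_ne_bot_iff fun _ => ⊤).2
          (Eventually.of_forall fun _ => top_ne_bot).frequently
      exact ⟨y, ⟨hy, hne⟩, hx, hy, hne, Or.inr (by simp only [h₀, inf_bot_eq])⟩
    · exact ⟨x, ⟨hx, h₀⟩, hx, hx, h₀, Or.inl le_rfl⟩
  exists_not_rel := by
    rintro y ⟨hy, hne⟩
    -- A nonzero element strictly below `y` splits `y`.
    obtain ⟨q, hq, hlt⟩ := ReducedPower.exists_ne_bot_lt hne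
    obtain ⟨⟨x, hx⟩, rfl⟩ := 𝔹.exists_toReducedPower_eq q
    refine ⟨x, ⟨hx, trivial⟩, fun ⟨hx', hy', _, hr⟩ => ?_⟩
    obtain hr | hr := hr
    · exact hlt.not_ge hr
    · exact hq (by rwa [inf_eq_right.2 hlt.le] at hr)

end CantorBooleanAlgebra

/-! ### Homogeneity -/

/-- Isomorphisms of `B` onto its relative algebras `B ↾ b`, as maps `φ b`, and their inverses
precomposed with the projection to `B ↾ b`, as maps `ψ b`. Whether `φ b x` reaps `c` can be tested
on `x` and `ψ b c`. -/
theorem exists_relative_isomorphisms {B : Type*} [BooleanAlgebra B]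
    (h : ∀ b : B, b ≠ ⊥ → Nonempty (B ≃o Iic b)) :
    ∃ φ ψ : B → B → B, (∀ b x, φ b x ≤ b) ∧ (∀ b x, b ≠ ⊥ → (φ b x = ⊥ ↔ x = ⊥)) ∧
      (∀ b x c, b ≠ ⊥ → x ≤ ψ b c → φ b x ≤ c) ∧
      ∀ b x c, b ≠ ⊥ → x ⊓ ψ b c = ⊥ → φ b x ⊓ c = ⊥ := by
  classical
  let iso : ∀ b : B, b ≠ ⊥ → (B ≃o Iic b) := fun b hb => (h b hb).some
  let φ : B → B → B := fun b x => if hb : b ≠ ⊥ then (iso b hb x : B) else ⊥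
  let ψ : B → B → B := fun b c =>
    if hb : b ≠ ⊥ then (iso b hb).symm ⟨c ⊓ b, inf_le_right⟩ else ⊥
  have hφ : ∀ b x (hb : b ≠ ⊥), φ b x = iso b hb x := fun b x hb => dif_pos hb
  have hψ : ∀ b c (hb : b ≠ ⊥), iso b hb (ψ b c) = ⟨c ⊓ b, inf_le_right⟩ := fun b c hb => by
    simp only [ψ, dif_pos hb, OrderIso.apply_symm_apply]
  have hbot : ∀ b x (hb : b ≠ ⊥), φ b x = ⊥ ↔ x = ⊥ := fun b x hb => by
    rw [hφ b x hb, ← map_eq_bot_iff (iso b hb) (a := x), ← Subtype.coe_inj]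
    rfl
  refine ⟨φ, ψ, fun b x => ?_, hbot, fun b x c hb hx => ?_, fun b x c hb hx => ?_⟩
  · by_cases hb : b ≠ ⊥
    · rw [hφ b x hb]
      exact (iso b hb x).2
    · simp only [φ, dif_neg hb, bot_le]
  · have h₁ := (iso b hb).monotone hx
    rw [hψ b c hb, ← Subtype.coe_le_coe] at h₁
    rw [hφ b x hb]
    exact h₁.trans inf_le_left
  · rw [← hbot b _ hb, hφ b _ hb, OrderIso.map_inf, hψ b c hb] at hx
    have h₁ : (iso b hb x : B) ⊓ (c ⊓ b) = ⊥ := hx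
    rw [hφ b x hb, eq_bot_iff, ← h₁]
    exact le_inf inf_le_left (le_inf inf_le_right (inf_le_left.trans (iso b hb x).2))

/-! ### Coding towers by branches -/

/-- The value at `c` of a `0`-`1` sequence of length `δ`, with the junk value `0` for `c ≥ δ`. -/
noncomputable def readBit (δ : OmegaOne) (f : Iio δ → Bool) (c : OmegaOne) : Bool :=
  if h : c < δ then f ⟨c, h⟩ else false

theorem measurable_readBit (δ c : OmegaOne) : Measurable fun f : Iio δ → Bool => readBit δ f c := by
  by_cases h : c < δ
  · simpa only [readBit, dif_pos h] using measurable_pi_apply _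
  · simpa only [readBit, dif_neg h] using measurable_const

/-- The relation between `k` and `n` read off from a `0`-`1` sequence of length `δ`: the bits coding
that `n` is a good position for the `k`-th of the members of the coded tower at the indices `s` are
all `1`. -/
def CodedGood (e : OmegaOne × OmegaOne × ℕ × ℕ → OmegaOne) (s : ℕ → OmegaOne) (δ : OmegaOne)
    (f : Iio δ → Bool) (k n : ℕ) : Prop :=
  ∀ j ≤ k, readBit δ f (e (s k, s j, n, 0)) = true

theorem measurableSet_codedGood (e : OmegaOne × OmegaOne × ℕ × ℕ → OmegaOne) (s : ℕ → OmegaOne)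
    (δ : OmegaOne) (k n : ℕ) : MeasurableSet {f | CodedGood e s δ f k n} := by
  have : {f | CodedGood e s δ f k n} =
      ⋂ j, ⋂ (_ : j ≤ k), (fun f => readBit δ f (e (s k, s j, n, 0))) ⁻¹' {true} := by
    ext f
    simp [CodedGood]
  rw [this]
  exact .iInter fun j => .iInter fun _ => measurable_readBit _ _ (measurableSet_singleton _)

namespace CantorBooleanAlgebra

variable (𝔹 : CantorBooleanAlgebra)

open Classical in
/-- The sequence in `𝔹` read off from a `0`-`1` sequence of length `δ`: its `k`-th entry is the
point coded at the index `s k` and the `k`-th diagonal position, or `⊥` if that point is not in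
`𝔹`. -/
noncomputable def codedSeq (e : OmegaOne × OmegaOne × ℕ × ℕ → OmegaOne) (s : ℕ → OmegaOne)
    (δ : OmegaOne) (f : Iio δ → Bool) (k : ℕ) : ℕ → Bool :=
  let x : ℕ → Bool := fun i =>
    readBit δ f (e (s k, s k, diagonalPositions (CodedGood e s δ f) k, i + 1))
  if x ∈ 𝔹.dom then x else 𝔹.val ⊥

theorem codedSeq_mem (e : OmegaOne × OmegaOne × ℕ × ℕ → OmegaOne) (s : ℕ → OmegaOne)
    (δ : OmegaOne) (f : Iio δ → Bool) : 𝔹.codedSeq e s δ f ∈ 𝔹.seqs := fun k => by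
  dsimp only [codedSeq]
  split_ifs with h
  · exact h
  · exact 𝔹.val_mem ⊥

variable {𝔹} in
/-- The diagonal positions depend measurably on the bits, and each of the resulting entries is read
off from countably many bits. -/
theorem IsBorel.measurable_codedSeq (h : 𝔹.IsBorel) (e : OmegaOne × OmegaOne × ℕ × ℕ → OmegaOne)
    (s : ℕ → OmegaOne) (δ : OmegaOne) : Measurable (𝔹.codedSeq e s δ) := by
  refine measurable_pi_lambda _ fun k => ?_
  have hread : Measurable fun f : Iio δ → Bool => fun i : ℕ =>
      readBit δ f (e (s k, s k, diagonalPositions (CodedGood e s δ f) k, i + 1)) := by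
    refine measurable_pi_lambda _ fun i => ?_
    have hpair : Measurable fun p : (Iio δ → Bool) × ℕ =>
        readBit δ p.1 (e (s k, s k, p.2, i + 1)) :=
      measurable_from_prod_countable_left fun n =>
        measurable_readBit δ (e (s k, s k, n, i + 1))
    exact hpair.comp
      (measurable_id.prodMk (measurable_diagonalPositions (measurableSet_codedGood e s δ) k))
  exact Measurable.ite (hread h.dom_borel) hread measurable_const

open Classical in
/-- The branch coding a tower `U` and a family `D` of points: at `e (ξ, ζ, n, 0)` it records
whether `U ξ n` is nonzero and below `U ζ n`, at `e (ξ, ζ, n, i + 1)` the `i`-th bit of `D ξ n`. -/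
noncomputable def codingBranch (e : OmegaOne × OmegaOne × ℕ × ℕ → OmegaOne)
    (U D : OmegaOne → ℕ → 𝔹.Elem) : OmegaOne → Bool :=
  Function.extend e (fun c => match c.2.2.2 with
    | 0 => decide (U c.1 c.2.2.1 ≠ ⊥ ∧ U c.1 c.2.2.1 ≤ U c.2.1 c.2.2.1)
    | i + 1 => 𝔹.val (D c.1 c.2.2.1) i) fun _ => false

/-- On levels closed under the coding, the restrictions of the coding branch are decoded
correctly. -/
theorem codedSeq_codingBranch {e : OmegaOne × OmegaOne × ℕ × ℕ → OmegaOne} (he : e.Injective)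
    (U D : OmegaOne → ℕ → 𝔹.Elem) {δ : OmegaOne}
    (hδ : ∀ ξ < δ, ∀ ζ < δ, ∀ n i, e (ξ, ζ, n, i) < δ) {s : ℕ → OmegaOne} (hs : ∀ k, s k < δ)
    (k : ℕ) :
    𝔹.codedSeq e s δ (fun β => 𝔹.codingBranch e U D β) k =
      𝔹.val (D (s k) (diagonalPositions (IsGoodPosition fun k => U (s k)) k)) := by
  have hread : ∀ j k n i, readBit δ (fun β => 𝔹.codingBranch e U D β) (e (s k, s j, n, i)) =
      𝔹.codingBranch e U D (e (s k, s j, n, i)) := fun j k n i =>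
    dif_pos (hδ _ (hs k) _ (hs j) n i)
  have hgood : CodedGood e s δ (fun β => 𝔹.codingBranch e U D β) =
      IsGoodPosition fun k => U (s k) := by
    funext k n
    simp only [CodedGood, IsGoodPosition, hread]
    simp only [codingBranch, he.extend_apply, decide_eq_true_eq]
  have hx : (fun i => readBit δ (fun β => 𝔹.codingBranch e U D β)
      (e (s k, s k, diagonalPositions (CodedGood e s δ fun β => 𝔹.codingBranch e U D β) k,
        i + 1))) = 𝔹.val (D (s k) (diagonalPositions (IsGoodPosition fun k => U (s k)) k)) := by
    funext i
    rw [hgood, hread]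
    simp only [codingBranch, he.extend_apply]
  dsimp only [codedSeq]
  rw [if_pos (hx ▸ 𝔹.val_mem _)]
  exact hx

/-! ### The diamond yields an ultrafilter -/

variable {𝔹} in
/-- The tower built from a diamond sequence `g` for the decoding functions generates an ultrafilter:
`C` is decided at any closure point `δ` at which `g δ` reaps the sequence decoded from the branch
that codes the tower and the elements `ψ (U ξ n) (C n)`. -/
theorem IsBorelHomogeneous.exists_ultrafilter (h : 𝔹.IsBorelHomogeneous)
    (hdiamond : 𝔹.reapingReducedPower.Diamond) :
    ∃ U : Order.PFilter (ReducedPower 𝔹.Elem), IsBooleanUltrafilter U ∧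
      Order.cof {a : ReducedPower 𝔹.Elem // a ∈ U}ᵒᵈ ≤ ℵ₁ := by
  obtain ⟨e, he⟩ := exists_injective_code
  choose η hη using exists_monotone_cofinal
  obtain ⟨φ, ψ, hφ, hφ₀, hφle, hφinf⟩ := exists_relative_isomorphisms
    fun b hb => ⟨(h.exists_iso b hb).choose⟩
  obtain ⟨g, hg⟩ := hdiamond
    (fun δ f => ⟨𝔹.codedSeq e (η δ) δ f, 𝔹.mem_reapingReducedPower_neg.2 (𝔹.codedSeq_mem e _ δ f)⟩)
    fun δ => (h.measurable_codedSeq e (η δ) δ).subtype_mk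
  choose hgmem hgne using fun δ => 𝔹.mem_reapingReducedPower_pos.1 (g δ).2
  obtain ⟨U, hUne, hUle, hU⟩ := exists_tower hη hφ hφ₀ hgne
  have hdec : ∀ c : ReducedPower 𝔹.Elem, ∃ δ, (U δ : ReducedPower 𝔹.Elem) ≤ c ∨
      (U δ : ReducedPower 𝔹.Elem) ⊓ c = ⊥ := fun c => by
    induction c using Filter.Germ.inductionOn with | _ C =>
    let D : OmegaOne → ℕ → 𝔹.Elem := fun ξ n => ψ (U ξ n) (C n)
    obtain ⟨δ, hδ, hne, hclosed⟩ := hg (𝔹.codingBranch e U D) (isClub_closed_under e)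
    obtain ⟨hgood, hUδ⟩ := hU δ hne
    obtain ⟨hx, hy, -, hr⟩ := 𝔹.mem_reapingReducedPower_rel.1 hδ
    -- Through `φ` and `ψ`, reaping `C` at `N k` is reaping the decoded sequence at `k`.
    let N := diagonalPositions (IsGoodPosition fun k => U (η δ k))
    have hN : N.Injective := diagonalPositions_injective hgood
    have hb : ∀ k, U (η δ k) (N k) ≠ ⊥ := fun k => (diagonalPositions_spec hgood k k le_rfl).1
    have hF : ∀ k, 𝔹.elemSeq ⟨_, hx⟩ k = ψ (U (η δ k) (N k)) (C (N k)) := fun k =>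
      𝔹.val_injective (𝔹.codedSeq_codingBranch he U D hclosed (hη δ hne).2.1 k)
    refine ⟨δ, ?_⟩
    rw [hUδ]
    refine hr.imp (fun hr => ?_) fun hr => ?_
    · refine Filter.Germ.coe_le.2 (eventually_spread (p := fun n b => b ≤ C n) hN
        (fun _ => bot_le) (hr.mono fun k hk => ?_))
      exact hφle _ _ _ (hb k) (hF k ▸ hk)
    · refine Filter.Germ.coe_eq.2 (eventually_spread (p := fun n b => b ⊓ C n = ⊥) hN
        (fun _ => bot_inf_eq _) (hr.mono fun k hk => ?_))
      exact hφinf _ _ _ (hb k) (hF k ▸ hk)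
  have : Nonempty OmegaOne := Ordinal.nonempty_toType_iff.2 (Ordinal.omega_pos 1).ne'
  obtain ⟨V, hV, hcof⟩ := exists_isBooleanUltrafilter_of_antitone
    (u := fun δ => (U δ : ReducedPower 𝔹.Elem))
    (fun ξ δ hξδ => Filter.Germ.coe_le.2 (hUle ξ δ hξδ))
    (fun δ => (ReducedPower.coe_ne_bot_iff _).2 (hUne δ)) hdec
  exact ⟨V, hV, hcof.trans cardinalMk_omega_one_toType.le⟩

end CantorBooleanAlgebra

theorem mainTheorem6 (𝔹 : CantorBooleanAlgebra) [Nontrivial 𝔹.Elem] (h𝔹 : 𝔹.IsBorel) :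
    𝔹.reapingReducedPower.IsBorel ∧
      (𝔹.IsBorelHomogeneous → 𝔹.reapingReducedPower.Diamond →
        ultrafilterNumber (ReducedPower 𝔹.Elem) = ℵ₁) := by
  refine ⟨h𝔹.isBorel_reapingReducedPower, fun hhom hdiamond => ?_⟩
  obtain ⟨U, hU, hcof⟩ := hhom.exists_ultrafilter hdiamond
  exact ultrafilterNumber_eq_aleph_one hU hcof
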